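/- A two-qubit Hamiltonian is a Hermitian matrix $H\in M_4(\mathbb{C})$ acting on $\mathbb{C}^2\otimes\mathbb{C}^2$. Let $T$ be the gate that swaps the two qubits, $T(|a\rangle\otimes|b\rangle)=|b\rangle\otimes|a\rangle$. We say that $H$ is 2-universal if every unitary $U\in U(4)$ can be simulated using $H$ and $THT$: for every $\varepsilon>0$ there exist $l\in\mathbb{N}$, matrices $A_1,\dots,A_l\in\{H,THT\}$ and times $t_1,\dots,t_l>0$ such that $$\bigl\|U-e^{-iA_1t_1}e^{-iA_2t_2}\cdots e^{-iA_lt_l}\bigr\|<\varepsilon$$ in the operator (spectral) norm. Matrices $A$ and $B$ are called $T$-similar if $B=PAP^\dagger$ for some unitary $P\in U(4)$ with $PT=TP$. A two-qubit Hamiltonian is called local if it has the form $H_1\otimes I+I\otimes H_2$ with Hermitian $H_1,H_2\in M_2(\mathbb{C})$. **Theorem.** A two-qubit Hamiltonian $H$ is 2-universal if and only if it satisfies none of the following conditions: 1. $H$ is $T$-similar to a local Hamiltonian; 2. $H$ shares an eigenvector with $T$ (there is a nonzero vector that is an eigenvector of both $H$ and $T$, possibly for different eigenvalues); 3. $\operatorname{tr}(H)=0$.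 -/

import Mathlib

open scoped Kronecker

namespace QubitUniversality

/-- The time evolution `e^{-iHt}` generated by `H` for time `t`. -/
noncomputable def evolution {ι : Type*} [Fintype ι] [DecidableEq ι]
    (H : Matrix ι ι ℂ) (t : ℝ) : Matrix ι ι ℂ :=
  NormedSpace.exp ((-(Complex.I * (t : ℂ))) • H)

section

/- Norms of matrices are operator norms for the Euclidean norm (spectral norms). -/
open scoped Matrix.Norms.L2Operator

/-- `U` can be simulated with the Hamiltonians in `S`: for every `ε > 0` there are Hamiltonians
`A₁, …, A_l ∈ S` and times `t₁, …, t_l > 0` (listed as pairs in `w`) with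
`‖U - e^{-i A₁ t₁} ⋯ e^{-i A_l t_l}‖ < ε`. -/
def CanSimulate {ι : Type*} [Fintype ι] [DecidableEq ι]
    (S : Set (Matrix ι ι ℂ)) (U : Matrix ι ι ℂ) : Prop :=
  ∀ ε : ℝ, 0 < ε → ∃ w : List (Matrix ι ι ℂ × ℝ),
    (∀ p ∈ w, p.1 ∈ S ∧ 0 < p.2) ∧
    ‖U - (w.map fun p => evolution p.1 p.2).prod‖ < ε

end

/-- Complex matrices acting on two qubits; the pair `(a, b)` labels the computational basis
vector `|ab⟩`. -/
abbrev TwoQubitMatrix : Type := Matrix (Fin 2 × Fin 2) (Fin 2 × Fin 2) ℂ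

/-- The gate `T` exchanging the two qubits, `T |ab⟩ = |ba⟩`. -/
def swapGate : TwoQubitMatrix :=
  Matrix.of fun i j => if i = j.swap then 1 else 0

/-- `H` is 2-universal: every unitary on two qubits can be simulated using `H` and `T H T`. -/
def IsTwoUniversal (H : TwoQubitMatrix) : Prop :=
  ∀ U ∈ Matrix.unitaryGroup (Fin 2 × Fin 2) ℂ,
    CanSimulate {H, swapGate * H * swapGate} U

/-- `A` and `B` are `T`-similar: `B = P A P†` for a unitary `P` commuting with `T`. -/
def TSimilar (A B : TwoQubitMatrix) : Prop :=
  ∃ P ∈ Matrix.unitaryGroup (Fin 2 × Fin 2) ℂ,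
    Commute P swapGate ∧ B = P * A * P.conjTranspose

/-- `H = H₁ ⊗ I + I ⊗ H₂` for one-qubit Hamiltonians `H₁` and `H₂`. -/
def IsLocalHamiltonian (H : TwoQubitMatrix) : Prop :=
  ∃ H₁ H₂ : Matrix (Fin 2) (Fin 2) ℂ, H₁.IsHermitian ∧ H₂.IsHermitian ∧
    H = H₁ ⊗ₖ (1 : Matrix (Fin 2) (Fin 2) ℂ) + (1 : Matrix (Fin 2) (Fin 2) ℂ) ⊗ₖ H₂

/-- `A` and `B` have a common eigenvector, possibly for different eigenvalues. -/
def ShareEigenvector (A B : TwoQubitMatrix) : Prop :=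
  ∃ v : Fin 2 × Fin 2 → ℂ, v ≠ 0 ∧
    (∃ α : ℂ, A.mulVec v = α • v) ∧ (∃ β : ℂ, B.mulVec v = β • v)

end QubitUniversality

/-! A unitary can be simulated exactly when it lies in the closed monoid generated by the evolutions
of H and THT. Each of the three conditions confines this monoid to a proper closed one: matrices
that are products A ⊗ B after a fixed conjugation, matrices having a fixed vector as eigenvector, or
matrices of determinant 1.

Conversely, compactness makes negative times available, so the Hamiltonians whose evolutions all lie
in the monoid form a real Lie algebra under i[A,B] (`evolutionSubmodule`,
`commutator_mem_evolutionSubmodule`). Since every unitary is some e^{-iA}, it suffices that this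
algebra contains every Hermitian matrix.

The gate T is -1 on the singlet and +1 on its orthogonal complement. If H and T share no
eigenvector, then H has none orthogonal to the singlet, so the singlet is cyclic for H. Lanczos
started there makes H tridiagonal with diagonal a and positive off-diagonal entries b₀, b₁, b₂,
while T becomes diag(-1,1,1,1). Thus THT differs from H only in the sign of b₀, and the difference
isolates X on the first edge of the path 0-1-2-3.

Brackets then peel off the other edges and the diagonal part (`mem_of_tridiagonal`). A nonconstant
diagonal yields a Y on some edge, hence every traceless Hamiltonian, and the nonzero trace supplies
the identity direction. If the diagonal is constant, the same tridiagonal matrix read in the Bell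
basis is local (`exists_local_mul_bellMatrix`), so H is T-similar to a local Hamiltonian. -/

namespace QubitUniversality

/-! ### Evolutions, closed monoids and the Lie algebra of simulable Hamiltonians -/

section Analysis

open scoped Matrix.Norms.L2Operator
open Filter Topology

variable {ι : Type*} [Fintype ι] [DecidableEq ι]

theorem evolution_eq (H : Matrix ι ι ℂ) (t : ℝ) :
    evolution H t = NormedSpace.exp (t • (-Complex.I • H)) := by
  unfold evolution
  congr 1
  ext i j
  simp [mul_left_comm, mul_assoc]

theorem evolution_zero (H : Matrix ι ι ℂ) : evolution H 0 = 1 := by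
  simp [evolution_eq]

theorem evolution_smul (H : Matrix ι ι ℂ) (s t : ℝ) :
    evolution (s • H) t = evolution H (s * t) := by
  simp only [evolution_eq]
  congr 1
  rw [smul_comm (-Complex.I) s, smul_smul, mul_comm]

theorem evolution_add (H : Matrix ι ι ℂ) (s t : ℝ) :
    evolution H (s + t) = evolution H s * evolution H t := by
  simp only [evolution_eq, add_smul]
  exact Matrix.exp_add_of_commute _ _ (((Commute.refl _).smul_left s).smul_right t)

theorem evolution_nsmul (H : Matrix ι ι ℂ) (t : ℝ) (n : ℕ) :
    evolution H (n * t) = evolution H t ^ n := by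
  induction n with
  | zero => simp [evolution_zero]
  | succ n ih => rw [pow_succ, ← ih, ← evolution_add]; congr 1; push_cast; ring

theorem star_evolution {H : Matrix ι ι ℂ} (hH : H.IsHermitian) (t : ℝ) :
    star (evolution H t) = evolution H (-t) := by
  rw [evolution, evolution, Matrix.star_eq_conjTranspose, ← Matrix.exp_conjTranspose,
    Matrix.conjTranspose_smul, hH.eq]
  simp

theorem evolution_mem_unitaryGroup {H : Matrix ι ι ℂ} (hH : H.IsHermitian) (t : ℝ) :
    evolution H t ∈ Matrix.unitaryGroup ι ℂ := by
  rw [Matrix.mem_unitaryGroup_iff, star_evolution hH, ← evolution_add]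
  simp [evolution_zero]

theorem evolution_conj {P : Matrix ι ι ℂ} (hP : P ∈ Matrix.unitaryGroup ι ℂ)
    (H : Matrix ι ι ℂ) (t : ℝ) :
    evolution (P * H * star P) t = P * evolution H t * star P := by
  have h1 := Matrix.mem_unitaryGroup_iff.1 hP
  have h : P⁻¹ = star P := Matrix.inv_eq_right_inv h1
  have hu : IsUnit P := (Matrix.isUnit_iff_isUnit_det _).2 (Matrix.isUnit_det_of_right_inverse h1)
  rw [← h, evolution, evolution, ← Matrix.exp_conj _ _ hu]
  simp

theorem hasDerivAt_evolution_zero (H : Matrix ι ι ℂ) :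
    HasDerivAt (evolution H) (-Complex.I • H) 0 := by
  have h := hasDerivAt_exp_smul_const (𝕂 := ℝ) (-Complex.I • H) (0 : ℝ)
  simp only [zero_smul, NormedSpace.exp_zero, one_mul] at h
  exact h.congr_of_eventuallyEq (Eventually.of_forall fun t => evolution_eq H t)

/-- The closed monoid generated by the evolutions of the Hamiltonians in `S`. -/
noncomputable def simulationMonoid (S : Set (Matrix ι ι ℂ)) : Submonoid (Matrix ι ι ℂ) :=
  (Submonoid.closure {U | ∃ A ∈ S, ∃ t : ℝ, 0 < t ∧ U = evolution A t}).topologicalClosure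

theorem isClosed_simulationMonoid (S : Set (Matrix ι ι ℂ)) :
    IsClosed (simulationMonoid S : Set (Matrix ι ι ℂ)) :=
  Submonoid.isClosed_topologicalClosure _

/-- Finite words in the evolutions are exactly the elements of the algebraic monoid closure, and
approximation by them is topological closure. -/
theorem canSimulate_iff {S : Set (Matrix ι ι ℂ)} {U : Matrix ι ι ℂ} :
    CanSimulate S U ↔ U ∈ simulationMonoid S := by
  have hcoe : (simulationMonoid S : Set (Matrix ι ι ℂ)) = closure
      (Submonoid.closure {U | ∃ A ∈ S, ∃ t : ℝ, 0 < t ∧ U = evolution A t}) := rfl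
  rw [← SetLike.mem_coe, hcoe, Metric.mem_closure_iff]
  refine forall₂_congr fun ε _ => ⟨?_, ?_⟩
  · rintro ⟨w, hw, h⟩
    refine ⟨_, Submonoid.list_prod_mem _ ?_, by rwa [dist_eq_norm]⟩
    simp only [List.mem_map]
    rintro _ ⟨p, hp, rfl⟩
    exact Submonoid.subset_closure ⟨p.1, (hw p hp).1, p.2, (hw p hp).2, rfl⟩
  · rintro ⟨V, hV, h⟩
    rw [dist_eq_norm] at h
    obtain ⟨w, hw, rfl⟩ : ∃ w : List (Matrix ι ι ℂ × ℝ), (∀ p ∈ w, p.1 ∈ S ∧ 0 < p.2) ∧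
        (w.map fun p => evolution p.1 p.2).prod = V := by
      clear h
      induction hV using Submonoid.closure_induction with
      | mem x hx =>
        obtain ⟨A, hA, t, ht, rfl⟩ := hx
        exact ⟨[(A, t)], by simp [hA, ht], by simp⟩
      | one => exact ⟨[], by simp, by simp⟩
      | mul x y _ _ hx hy =>
        obtain ⟨w₁, h₁, rfl⟩ := hx
        obtain ⟨w₂, h₂, rfl⟩ := hy
        refine ⟨w₁ ++ w₂, fun p hp => ?_, by simp⟩
        rcases List.mem_append.1 hp with hp | hp
        exacts [h₁ p hp, h₂ p hp]
    exact ⟨w, hw, h⟩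

theorem simulationMonoid_le {S : Set (Matrix ι ι ℂ)} {M : Submonoid (Matrix ι ι ℂ)}
    (hM : IsClosed (M : Set (Matrix ι ι ℂ))) (h : ∀ A ∈ S, ∀ t : ℝ, evolution A t ∈ M) :
    simulationMonoid S ≤ M := by
  refine Submonoid.topologicalClosure_minimal _ (Submonoid.closure_le.2 ?_) hM
  rintro _ ⟨A, hA, t, -, rfl⟩
  exact h A hA t

theorem isClosed_unitaryGroup : IsClosed (Matrix.unitaryGroup ι ℂ : Set (Matrix ι ι ℂ)) := by
  have : (Matrix.unitaryGroup ι ℂ : Set (Matrix ι ι ℂ)) = {U | U * star U = 1} := by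
    ext U
    exact Matrix.mem_unitaryGroup_iff
  rw [this]
  exact isClosed_eq (by fun_prop) continuous_const

theorem norm_le_one_of_mem_unitaryGroup {U : Matrix ι ι ℂ} (hU : U ∈ Matrix.unitaryGroup ι ℂ) :
    ‖U‖ ≤ 1 := by
  rcases subsingleton_or_nontrivial (Matrix ι ι ℂ) with h | h
  · simp [Subsingleton.elim U 0]
  · exact (CStarRing.norm_of_mem_unitary hU).le

/-- The inverse of a unitary matrix is a limit of its powers. -/
theorem star_mem_of_isClosed {M : Submonoid (Matrix ι ι ℂ)}
    (hM : IsClosed (M : Set (Matrix ι ι ℂ))) {U : Matrix ι ι ℂ}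
    (hU : U ∈ Matrix.unitaryGroup ι ℂ) (hUM : U ∈ M) : star U ∈ M := by
  have : ProperSpace (Matrix ι ι ℂ) := FiniteDimensional.proper ℂ _
  have hc : IsCompact (Matrix.unitaryGroup ι ℂ : Set (Matrix ι ι ℂ)) :=
    Metric.isCompact_of_isClosed_isBounded isClosed_unitaryGroup
      (isBounded_iff_forall_norm_le.2 ⟨1, fun V hV => norm_le_one_of_mem_unitaryGroup hV⟩)
  -- Along a convergent subsequence of powers, U^(φ(n+1) - φ(n)) tends to 1. Removing one factor U
  -- gives powers tending to U⁻¹; their exponents are natural numbers because φ is strictly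
  -- increasing.
  obtain ⟨a, ha, φ, hφ, hlim⟩ := hc.tendsto_subseq (x := fun n => U ^ n) fun n => pow_mem hU n
  have hlim' := hlim.comp (tendsto_add_atTop_nat 1)
  have h : Tendsto (fun n => star (U ^ φ n) * U ^ φ (n + 1) * star U) atTop
      (𝓝 (star a * a * star U)) :=
    ((hlim.star).mul hlim').mul_const _
  rw [Matrix.mem_unitaryGroup_iff'.1 ha, one_mul] at h
  refine hM.mem_of_tendsto h (Eventually.of_forall fun n => ?_)
  obtain ⟨k, hk⟩ := Nat.exists_eq_add_of_lt (hφ (Nat.lt_succ_self n))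
  have : star (U ^ φ n) * U ^ φ (n + 1) * star U = U ^ k := by
    rw [show φ (n + 1) = φ n + (k + 1) by simpa [add_assoc] using hk, pow_add, ← mul_assoc,
      Matrix.mem_unitaryGroup_iff'.1 (pow_mem hU _), one_mul, pow_succ, mul_assoc,
      Matrix.mem_unitaryGroup_iff.1 hU, mul_one]
  rw [this]
  exact pow_mem hUM k

/-- Telescoping: all powers are contractions, so the one-step errors only add up. -/
theorem norm_pow_sub_pow_le {R : Type*} [NormedRing R] {a b : R} (hb : ‖b‖ ≤ 1)
    (ha : ∀ n : ℕ, ‖a ^ n‖ ≤ 1) (n : ℕ) : ‖a ^ n - b ^ n‖ ≤ n * ‖a - b‖ := by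
  induction n with
  | zero => simp
  | succ n ih =>
    have : a ^ (n + 1) - b ^ (n + 1) = a ^ n * (a - b) + (a ^ n - b ^ n) * b := by
      simp only [pow_succ]; noncomm_ring
    rw [this]
    calc ‖a ^ n * (a - b) + (a ^ n - b ^ n) * b‖
        ≤ ‖a ^ n‖ * ‖a - b‖ + ‖a ^ n - b ^ n‖ * ‖b‖ :=
          (norm_add_le _ _).trans (add_le_add (norm_mul_le _ _) (norm_mul_le _ _))
      _ ≤ 1 * ‖a - b‖ + (n * ‖a - b‖) * 1 := by
          gcongr
          exact ha n
      _ = _ := by push_cast; ring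

/-- The Lie product formula for Hamiltonian evolutions. -/
theorem tendsto_evolution_mul_pow {A B : Matrix ι ι ℂ} (hA : A.IsHermitian) (hB : B.IsHermitian)
    (t : ℝ) :
    Tendsto (fun n : ℕ => (evolution A (t / (n + 1)) * evolution B (t / (n + 1))) ^ (n + 1)) atTop
      (𝓝 (evolution (A + B) t)) := by
  -- The two sides agree to first order at 0, so one step of length t/(n+1) costs o(1/(n+1)) and n+1
  -- steps cost o(1).
  have hd : HasDerivAt (fun s => evolution A s * evolution B s - evolution (A + B) s) 0 0 := by
    have h := ((hasDerivAt_evolution_zero A).mul (hasDerivAt_evolution_zero B)).sub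
      (hasDerivAt_evolution_zero (A + B))
    have h0 : -Complex.I • A * evolution B 0 + evolution A 0 * -Complex.I • B -
        -Complex.I • (A + B) = 0 := by simp [evolution_zero]
    exact h0 ▸ h
  have hs : Tendsto (fun n : ℕ => t / ((n : ℝ) + 1)) atTop (𝓝 0) := by
    simpa [div_eq_mul_inv] using (tendsto_one_div_add_atTop_nhds_zero_nat (𝕜 := ℝ)).const_mul t
  have ho := (hasDerivAt_iff_isLittleO.1 hd).comp_tendsto hs
  simp only [evolution_zero, Function.comp_def, smul_zero, sub_zero, mul_one, sub_self] at ho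
  rw [tendsto_iff_norm_sub_tendsto_zero]
  rw [Metric.tendsto_atTop]
  intro ε hε
  -- The added 1 also covers t = 0.
  have hε' : 0 < ε / (|t| + 1) := by positivity
  obtain ⟨N, hN⟩ := eventually_atTop.1 (ho.def hε')
  refine ⟨N, fun n hn => ?_⟩
  have hUn : ∀ s, evolution A s * evolution B s ∈ Matrix.unitaryGroup ι ℂ := fun s =>
    mul_mem (evolution_mem_unitaryGroup hA s) (evolution_mem_unitaryGroup hB s)
  have h1 := norm_pow_sub_pow_le
    (norm_le_one_of_mem_unitaryGroup (evolution_mem_unitaryGroup (hA.add hB) (t / ((n : ℝ) + 1))))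
    (fun k => norm_le_one_of_mem_unitaryGroup (pow_mem (hUn (t / ((n : ℝ) + 1))) k)) (n + 1)
  have hnt : ((n + 1 : ℕ) : ℝ) * (t / ((n : ℝ) + 1)) = t := by
    push_cast; field_simp
  rw [← evolution_nsmul, hnt] at h1
  have h2 := hN n hn
  rw [Real.dist_eq, sub_zero, abs_of_nonneg (norm_nonneg _)]
  refine h1.trans_lt ?_
  calc ((n + 1 : ℕ) : ℝ) * _ ≤ ((n + 1 : ℕ) : ℝ) * (ε / (|t| + 1) * ‖t / ((n : ℝ) + 1)‖) := by
        gcongr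
    _ = ε / (|t| + 1) * |t| := by
        rw [Real.norm_eq_abs, abs_div, abs_of_pos (by positivity : (0 : ℝ) < (n : ℝ) + 1)]
        push_cast; field_simp
    _ < ε := by
        rw [div_mul_eq_mul_div, div_lt_iff₀ (by positivity)]
        nlinarith [abs_nonneg t]

/-- The Hamiltonians whose evolutions belong to a closed monoid of matrices. -/
noncomputable def evolutionSubmodule (M : Submonoid (Matrix ι ι ℂ))
    (hM : IsClosed (M : Set (Matrix ι ι ℂ))) : Submodule ℝ (Matrix ι ι ℂ) where
  carrier := {A | A.IsHermitian ∧ ∀ t : ℝ, evolution A t ∈ M}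
  zero_mem' := ⟨Matrix.isHermitian_zero, fun t => by simp [evolution, one_mem]⟩
  add_mem' := by
    rintro A B ⟨hA, hA'⟩ ⟨hB, hB'⟩
    exact ⟨hA.add hB, fun t => hM.mem_of_tendsto (tendsto_evolution_mul_pow hA hB t)
      (Eventually.of_forall fun n => pow_mem (mul_mem (hA' _) (hB' _)) _)⟩
  smul_mem' := by
    rintro r A ⟨hA, hA'⟩
    exact ⟨by rw [Matrix.IsHermitian, Matrix.conjTranspose_smul, hA.eq, star_trivial],
      fun t => by rw [evolution_smul]; exact hA' _⟩

/-- The conjugates e^{iAs} B e^{-iAs} stay in the subspace and have derivative i[A,B] at s = 0. A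
finite-dimensional subspace is closed, so it contains this limit of difference quotients. -/
theorem commutator_mem_evolutionSubmodule {M : Submonoid (Matrix ι ι ℂ)}
    {hM : IsClosed (M : Set (Matrix ι ι ℂ))} {A B : Matrix ι ι ℂ}
    (hA : A ∈ evolutionSubmodule M hM) (hB : B ∈ evolutionSubmodule M hM) :
    Complex.I • (A * B - B * A) ∈ evolutionSubmodule M hM := by
  have hg : ∀ s : ℝ, evolution A (-s) * B * evolution A s ∈ evolutionSubmodule M hM := by
    intro s
    have hs : evolution A s = star (evolution A (-s)) := by rw [star_evolution hA.1, neg_neg]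
    refine ⟨?_, fun t => ?_⟩
    · rw [hs]; exact Matrix.isHermitian_mul_mul_conjTranspose _ hB.1
    · rw [hs, evolution_conj (evolution_mem_unitaryGroup hA.1 _), ← hs]
      exact mul_mem (mul_mem (hA.2 _) (hB.2 _)) (hA.2 _)
  have hd : HasDerivAt (fun s : ℝ => evolution A (-s) * B * evolution A s)
      (Complex.I • (A * B - B * A)) 0 := by
    have h1 : HasDerivAt (fun s : ℝ => evolution A (-s)) (Complex.I • A) 0 := by
      have h := hasDerivAt_evolution_zero (-A)
      simp only [neg_smul_neg] at h
      refine h.congr_of_eventuallyEq (Eventually.of_forall fun t => ?_)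
      simp [evolution]
    have h := (h1.mul_const B).mul (hasDerivAt_evolution_zero A)
    have h0 : Complex.I • A * B * evolution A 0 + evolution A (-0) * B * -Complex.I • A =
        Complex.I • (A * B - B * A) := by simp [evolution_zero, sub_eq_add_neg]
    exact h0 ▸ h
  have hcl : IsClosed (evolutionSubmodule M hM : Set (Matrix ι ι ℂ)) :=
    Submodule.closed_of_finiteDimensional _
  rw [hasDerivAt_iff_tendsto_slope] at hd
  refine hcl.mem_of_tendsto hd (Eventually.of_forall fun s => ?_)
  exact Submodule.smul_mem _ _ (Submodule.sub_mem _ (hg s) (hg 0))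

theorem mem_evolutionSubmodule_simulationMonoid {S : Set (Matrix ι ι ℂ)}
    (hS : ∀ A ∈ S, A.IsHermitian) {A : Matrix ι ι ℂ} (hA : A ∈ S) :
    A ∈ evolutionSubmodule (simulationMonoid S) (isClosed_simulationMonoid S) := by
  have hpos : ∀ t : ℝ, 0 < t → evolution A t ∈ simulationMonoid S := fun t ht =>
    Submonoid.le_topologicalClosure _ (Submonoid.subset_closure ⟨A, hA, t, ht, rfl⟩)
  refine ⟨hS A hA, fun t => ?_⟩
  rcases lt_trichotomy t 0 with ht | rfl | ht
  · have := star_mem_of_isClosed (isClosed_simulationMonoid S)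
      (evolution_mem_unitaryGroup (hS A hA) _) (hpos (-t) (by linarith))
    rwa [star_evolution (hS A hA), neg_neg] at this
  · rw [evolution_zero]; exact one_mem _
  · exact hpos t ht

/-- Every unitary matrix is the evolution of a Hamiltonian. -/
theorem exists_eq_evolution {U : Matrix ι ι ℂ} (hU : U ∈ Matrix.unitaryGroup ι ℂ) :
    ∃ A : Matrix ι ι ℂ, A.IsHermitian ∧ U = evolution A 1 := by
  have hn : IsStarNormal U := ⟨by
    rw [Commute, SemiconjBy, Matrix.mem_unitaryGroup_iff.1 hU, Matrix.mem_unitaryGroup_iff'.1 hU]⟩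
  -- The spectrum is finite, so the branch cut of `arg` is harmless and A = -arg(U) makes sense by
  -- functional calculus.
  have hc : ContinuousOn Complex.arg (spectrum ℂ U) :=
    (Matrix.finite_spectrum U).continuousOn _
  have hc' : ContinuousOn (Complex.ofReal ∘ Complex.arg) (spectrum ℂ U) :=
    (Matrix.finite_spectrum U).continuousOn _
  refine ⟨-cfc (Complex.ofReal ∘ Complex.arg : ℂ → ℂ) U, (IsSelfAdjoint.cfc_arg U).neg, ?_⟩
  rw [evolution_eq, one_smul, neg_smul_neg, ← CFC.exp_eq_normedSpace_exp (𝕜 := ℂ),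
    ← cfc_comp_smul .., ← cfc_comp' ..]
  conv_lhs => rw [← cfc_id' ℂ U]
  refine cfc_congr fun y hy ↦ ?_
  have hy₁ : ‖y‖ = 1 := spectrum.norm_eq_one_of_unitary hU hy
  have : Complex.I * y.arg = Complex.log y :=
    Complex.ext (by simp [Complex.log_re, hy₁]) (by simp [Complex.log_im])
  have hy₂ : y ≠ 0 := by
    rintro rfl
    simp at hy₁
  simpa [← Complex.exp_eq_exp_ℂ, this] using (Complex.exp_log hy₂).symm

end Analysis

/-! ### Generating all Hermitian 4 × 4 matrices by commutators -/

section LieAlgebra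

variable {n : Type*} [Fintype n] [DecidableEq n]

/-- The commutator of two Hamiltonians, normalised to be Hermitian. -/
noncomputable def hermitianBracket (A B : Matrix n n ℂ) : Matrix n n ℂ :=
  Complex.I • (A * B - B * A)

theorem hermitianBracket_add (A B C : Matrix n n ℂ) :
    hermitianBracket A (B + C) = hermitianBracket A B + hermitianBracket A C := by
  simp only [hermitianBracket, mul_add, add_mul, ← smul_add]
  congr 1
  abel

theorem hermitianBracket_smul (r : ℝ) (A B : Matrix n n ℂ) :
    hermitianBracket A (r • B) = r • hermitianBracket A B := by
  simp only [hermitianBracket, mul_smul_comm, smul_mul_assoc, ← smul_sub]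
  rw [smul_comm]

theorem hermitianBracket_I_smul (A B : Matrix n n ℂ) :
    hermitianBracket A (Complex.I • B) = B * A - A * B := by
  simp only [hermitianBracket, mul_smul_comm, smul_mul_assoc, ← smul_sub, smul_smul,
    Complex.I_mul_I, neg_one_smul, neg_sub]

/-- The Hamiltonian acting as Pauli `X` on the plane of the basis vectors `j` and `k`. -/
noncomputable def planeX (j k : n) : Matrix n n ℂ :=
  Matrix.single j k 1 + Matrix.single k j 1

/-- The Hamiltonian acting as Pauli `-Y` on the plane of the basis vectors `j` and `k`. -/
noncomputable def planeY (j k : n) : Matrix n n ℂ :=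
  Complex.I • (Matrix.single j k 1 - Matrix.single k j 1)

omit [Fintype n] in
theorem planeX_comm (j k : n) : planeX j k = planeX k j := add_comm _ _

omit [Fintype n] in
theorem planeY_comm (j k : n) : planeY j k = -planeY k j := by
  simp only [planeY, ← smul_neg, neg_sub]

theorem bracket_planeX_planeX {j k l : n} (hjk : j ≠ k) (hkl : k ≠ l) (hjl : j ≠ l) :
    hermitianBracket (planeX j k) (planeX k l) = planeY j l := by
  simp [hermitianBracket, planeX, planeY, mul_add, add_mul, Matrix.single_mul_single_of_ne,
    hjk, hkl, hjl, hjk.symm, hkl.symm, hjl.symm]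

theorem bracket_planeX_planeX_of_disjoint {j k l m : n} (hjl : j ≠ l) (hjm : j ≠ m)
    (hkl : k ≠ l) (hkm : k ≠ m) : hermitianBracket (planeX j k) (planeX l m) = 0 := by
  simp [hermitianBracket, planeX, mul_add, add_mul, Matrix.single_mul_single_of_ne,
    hjl, hjm, hkl, hkm, hjl.symm, hjm.symm, hkl.symm, hkm.symm]

theorem bracket_planeX_planeY {j k l : n} (hjk : j ≠ k) (hkl : k ≠ l) (hjl : j ≠ l) :
    hermitianBracket (planeX j k) (planeY k l) = -planeX j l := by
  rw [planeY, hermitianBracket_I_smul]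
  simp [planeX, mul_add, add_mul, mul_sub, sub_mul, Matrix.single_mul_single_of_ne,
    hjk, hkl, hjl, hjk.symm, hkl.symm, hjl.symm]
  abel

theorem bracket_planeX_planeY_self {j k : n} (hjk : j ≠ k) :
    hermitianBracket (planeX j k) (planeY j k) =
      (2 : ℝ) • (Matrix.single j j 1 - Matrix.single k k 1) := by
  rw [planeY, hermitianBracket_I_smul]
  simp [planeX, mul_add, add_mul, mul_sub, sub_mul, Matrix.single_mul_single_of_ne,
    hjk, hjk.symm, two_smul]
  abel

omit [Fintype n] in
theorem single_sub_single_eq_diagonal (j k : n) :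
    (Matrix.single j j 1 - Matrix.single k k 1 : Matrix n n ℂ) =
      Matrix.diagonal fun i =>
        (((if i = j then 1 else 0) - (if i = k then 1 else 0) : ℝ) : ℂ) := by
  ext p q
  rcases eq_or_ne p q with rfl | h
  · by_cases h1 : j = p <;> by_cases h2 : k = p <;> simp [h1, h2, eq_comm]
  · simp [Matrix.single_apply, h]
    grind

theorem bracket_planeX_diagonal (j k : n) (a : n → ℝ) :
    hermitianBracket (planeX j k) (Matrix.diagonal fun i => (a i : ℂ)) =
      (a k - a j) • planeY j k := by
  ext p q
  by_cases h1 : j = p <;> by_cases h2 : k = p <;> by_cases h3 : j = q <;> by_cases h4 : k = q <;>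
    simp [hermitianBracket, planeX, planeY, Matrix.single_apply, h1, h2, h3, h4] <;>
    grind

variable {V : Submodule ℝ (Matrix n n ℂ)}

theorem planeX_mem_of_planeY (hV : ∀ A ∈ V, ∀ B ∈ V, hermitianBracket A B ∈ V) (j k l : n)
    (hX : planeX j k ∈ V) (hY : planeY k l ∈ V)
    (hjk : j ≠ k := by decide) (hkl : k ≠ l := by decide) (hjl : j ≠ l := by decide) :
    planeX j l ∈ V := by
  have := hV _ hX _ hY
  rwa [bracket_planeX_planeY hjk hkl hjl, V.neg_mem_iff] at this

theorem planeY_mem_of_planeX (hV : ∀ A ∈ V, ∀ B ∈ V, hermitianBracket A B ∈ V) (j k l : n)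
    (hX : planeX j k ∈ V) (hY : planeX k l ∈ V)
    (hjk : j ≠ k := by decide) (hkl : k ≠ l := by decide) (hjl : j ≠ l := by decide) :
    planeY j l ∈ V := by
  have := hV _ hX _ hY
  rwa [bracket_planeX_planeX hjk hkl hjl] at this

omit [Fintype n] in
theorem planeX_mem_comm {j k : n} (h : planeX j k ∈ V) : planeX k j ∈ V := planeX_comm j k ▸ h

omit [Fintype n] in
theorem planeY_mem_comm {j k : n} (h : planeY j k ∈ V) : planeY k j ∈ V := by
  rwa [planeY_comm, V.neg_mem_iff]

/-- One step along a path: from `planeX j k` and a Hamiltonian `diag a + b X_{kl} + R`, where `R`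
commutes with `planeX j k`, the two components of their commutator can be separated. -/
theorem planeY_mem_of_diagonal_add (hV : ∀ A ∈ V, ∀ B ∈ V, hermitianBracket A B ∈ V)
    {j k l : n} (hjk : j ≠ k) (hkl : k ≠ l) (hjl : j ≠ l) {a : n → ℝ} {b : ℝ} (hb : b ≠ 0)
    {R : Matrix n n ℂ} (hR : hermitianBracket (planeX j k) R = 0) (hX : planeX j k ∈ V)
    (hD : Matrix.diagonal (fun i => (a i : ℂ)) + b • planeX k l + R ∈ V) :
    planeY j l ∈ V ∧ (a k - a j) • planeY j k ∈ V := by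
  have h1 := hV _ hX _ hD
  -- The square of bracketing with X_{jk} is -4 on Y_{jk} and -1 on Y_{jl}, so 4 h1 + h3 keeps only
  -- 3b Y_{jl}.
  have h3 := hV _ hX _ (hV _ hX _ h1)
  have e1 : hermitianBracket (planeX j k)
      (Matrix.diagonal (fun i => (a i : ℂ)) + b • planeX k l + R) =
      (a k - a j) • planeY j k + b • planeY j l := by
    rw [hermitianBracket_add, hermitianBracket_add, hR, add_zero, hermitianBracket_smul,
      bracket_planeX_diagonal, bracket_planeX_planeX hjk hkl hjl]
  have e2 : hermitianBracket (planeX j k) (planeY j l) = -planeX k l := by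
    rw [planeX_comm j k, bracket_planeX_planeY hjk.symm hjl hkl]
  have e4 : hermitianBracket (planeX j k) (Matrix.single j j 1 - Matrix.single k k 1) =
      (-2 : ℝ) • planeY j k := by
    rw [single_sub_single_eq_diagonal, bracket_planeX_diagonal]
    simp [hjk, hjk.symm]
    norm_num
  have e5 : hermitianBracket (planeX j k) (-planeX k l) = -planeY j l := by
    rw [← neg_one_smul ℝ (planeX k l), hermitianBracket_smul, bracket_planeX_planeX hjk hkl hjl,
      neg_one_smul]
  rw [e1] at h1 h3
  simp only [hermitianBracket_add, hermitianBracket_smul, e2, e4, e5,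
    bracket_planeX_planeY_self hjk] at h3
  have hY : planeY j l ∈ V := by
    have := V.smul_mem (3 * b)⁻¹ (V.add_mem (V.smul_mem 4 h1) h3)
    convert this using 1
    match_scalars
    · field_simp; ring
    · ring
  refine ⟨hY, ?_⟩
  have := V.sub_mem h1 (V.smul_mem b hY)
  rwa [add_sub_cancel_right] at this

theorem eq_sum_of_isHermitian {A : Matrix (Fin 4) (Fin 4) ℂ} (hA : A.IsHermitian) :
    A = (∑ j, (A j j).re • Matrix.single j j (1 : ℂ)) +
      ∑ j, ∑ k, if j < k then (A j k).re • planeX j k + (A j k).im • planeY j k else 0 := by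
  have h : ∀ i j, (A i j).re = (A j i).re ∧ (A i j).im = -(A j i).im := fun i j => by
    simp [← hA.apply i j]
  have hd : ∀ i, (A i i).im = 0 := fun i => by linarith [(h i i).2]
  ext p q
  rw [Complex.ext_iff]
  simp only [Fin.sum_univ_four, Matrix.add_apply]
  fin_cases p <;> fin_cases q <;>
    simp [planeX, planeY, hd]
  all_goals exact h _ _

/-- A space of Hamiltonians closed under commutators that contains `X` on all edges of the path
`0 - 1 - 2 - 3`, some `Y` on an edge, and a diagonal matrix of nonzero trace, is everything. -/
theorem mem_of_path {V : Submodule ℝ (Matrix (Fin 4) (Fin 4) ℂ)}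
    (hV : ∀ A ∈ V, ∀ B ∈ V, hermitianBracket A B ∈ V)
    (h01 : planeX 0 1 ∈ V) (h12 : planeX 1 2 ∈ V) (h23 : planeX 2 3 ∈ V)
    (hY : planeY 0 1 ∈ V ∨ planeY 1 2 ∈ V ∨ planeY 2 3 ∈ V)
    {a : Fin 4 → ℝ} (ha : Matrix.diagonal (fun i => (a i : ℂ)) ∈ V) (htr : ∑ i, a i ≠ 0)
    {A : Matrix (Fin 4) (Fin 4) ℂ} (hA : A.IsHermitian) : A ∈ V := by
  have y02 := planeY_mem_of_planeX hV 0 1 2 h01 h12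
  have y13 := planeY_mem_of_planeX hV 1 2 3 h12 h23
  have x03 := planeX_mem_of_planeY hV 0 1 3 h01 y13
  -- The three path X's alone span, with Y_{02}, Y_{13} and X_{03}, a six-dimensional algebra. The Y
  -- on an edge is what leads out of it.
  have x02 : planeX 0 2 ∈ V := by
    rcases hY with h | h | h
    · exact planeX_mem_comm
        (planeX_mem_of_planeY hV 2 1 0 (planeX_mem_comm h12) (planeY_mem_comm h))
    · exact planeX_mem_of_planeY hV 0 1 2 h01 h
    · exact planeX_mem_of_planeY hV 0 3 2 x03 (planeY_mem_comm h)
  have y12 := planeY_mem_of_planeX hV 1 0 2 (planeX_mem_comm h01) x02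
  have y01 := planeY_mem_of_planeX hV 0 2 1 x02 (planeX_mem_comm h12)
  have y03 := planeY_mem_of_planeX hV 0 2 3 x02 h23
  have y23 := planeY_mem_of_planeX hV 2 0 3 (planeX_mem_comm x02) x03
  have x13 := planeX_mem_of_planeY hV 1 2 3 h12 y23
  have hdiff : ∀ {j k : Fin 4}, j ≠ k → planeX j k ∈ V → planeY j k ∈ V →
      (Matrix.single j j 1 - Matrix.single k k 1 : Matrix (Fin 4) (Fin 4) ℂ) ∈ V := by
    intro j k hjk hx hy
    have := V.smul_mem (2⁻¹ : ℝ) (hV _ hx _ hy)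
    rwa [bracket_planeX_planeY_self hjk, smul_smul, inv_mul_cancel₀ two_ne_zero, one_smul] at this
  have d1 := hdiff (by decide) h01 y01
  have d2 := hdiff (by decide) x02 y02
  have d3 := hdiff (by decide) x03 y03
  -- Modulo the differences E_00 - E_jj, the diagonal matrix is its trace times E_00.
  have e0 : (Matrix.single 0 0 1 : Matrix (Fin 4) (Fin 4) ℂ) ∈ V := by
    have := V.smul_mem (∑ i, a i)⁻¹ (V.add_mem (V.add_mem (V.add_mem ha (V.smul_mem (a 1) d1))
      (V.smul_mem (a 2) d2)) (V.smul_mem (a 3) d3))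
    have hdiag : Matrix.diagonal (fun i => (a i : ℂ)) =
        ∑ i, a i • (Matrix.single i i 1 : Matrix (Fin 4) (Fin 4) ℂ) := by
      rw [← Matrix.sum_single_eq_diagonal]
      simp [Matrix.smul_single]
    have hsum : (Matrix.diagonal (fun i => (a i : ℂ)) +
        a 1 • (Matrix.single 0 0 1 - Matrix.single 1 1 1) +
        a 2 • (Matrix.single 0 0 1 - Matrix.single 2 2 1) +
        a 3 • (Matrix.single 0 0 1 - Matrix.single 3 3 1) : Matrix (Fin 4) (Fin 4) ℂ) =
        (∑ i, a i) • Matrix.single 0 0 1 := by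
      rw [hdiag, Fin.sum_univ_four, Fin.sum_univ_four]
      module
    rwa [hsum, smul_smul, inv_mul_cancel₀ htr, one_smul] at this
  have e : ∀ j : Fin 4, (Matrix.single j j 1 : Matrix (Fin 4) (Fin 4) ℂ) ∈ V := by
    intro j
    fin_cases j
    · exact e0
    · simpa using V.sub_mem e0 d1
    · simpa using V.sub_mem e0 d2
    · simpa using V.sub_mem e0 d3
  rw [eq_sum_of_isHermitian hA]
  refine V.add_mem (V.sum_mem fun j _ => V.smul_mem _ (e j))
    (V.sum_mem fun j _ => V.sum_mem fun k _ => ?_)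
  split_ifs with hjk
  · refine V.add_mem (V.smul_mem _ ?_) (V.smul_mem _ ?_) <;>
      fin_cases j <;> fin_cases k <;> first | assumption | exact absurd hjk (by decide)
  · exact V.zero_mem

/-- A tridiagonal Hamiltonian together with `X` on the first edge of the path generates all
Hamiltonians, unless it has constant diagonal or zero trace. -/
theorem mem_of_tridiagonal {V : Submodule ℝ (Matrix (Fin 4) (Fin 4) ℂ)}
    (hV : ∀ A ∈ V, ∀ B ∈ V, hermitianBracket A B ∈ V)
    {a : Fin 4 → ℝ} {b₁ b₂ : ℝ} (hb₁ : b₁ ≠ 0) (hb₂ : b₂ ≠ 0)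
    (h01 : planeX 0 1 ∈ V)
    (hD : Matrix.diagonal (fun i => (a i : ℂ)) + b₁ • planeX 1 2 + b₂ • planeX 2 3 ∈ V)
    (htr : ∑ i, a i ≠ 0) (ha : ¬ (a 1 = a 0 ∧ a 2 = a 1 ∧ a 3 = a 2))
    {A : Matrix (Fin 4) (Fin 4) ℂ} (hA : A.IsHermitian) : A ∈ V := by
  -- The far edge X_{23} is disjoint from X_{01} and plays the part of R.
  obtain ⟨y02, s01⟩ := planeY_mem_of_diagonal_add hV (j := 0) (k := 1) (l := 2) (by decide)
    (by decide) (by decide) hb₁ (by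
      rw [hermitianBracket_smul, bracket_planeX_planeX_of_disjoint (by decide) (by decide)
        (by decide) (by decide), smul_zero]) h01 hD
  have h12 := planeX_mem_of_planeY hV 1 0 2 (planeX_mem_comm h01) y02
  have hD' : Matrix.diagonal (fun i => (a i : ℂ)) + b₂ • planeX 2 3 ∈ V := by
    have := V.sub_mem hD (V.smul_mem b₁ h12)
    rwa [add_right_comm, add_sub_cancel_right] at this
  obtain ⟨y13, s12⟩ := planeY_mem_of_diagonal_add hV (j := 1) (k := 2) (l := 3) (R := 0)
    (by decide) (by decide) (by decide) hb₂ (by simp [hermitianBracket]) h12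
    (by rwa [add_zero])
  have h23 := planeX_mem_of_planeY hV 2 1 3 (planeX_mem_comm h12) y13
  have hdiag : Matrix.diagonal (fun i => (a i : ℂ)) ∈ V := by
    have := V.sub_mem hD' (V.smul_mem b₂ h23)
    rwa [add_sub_cancel_right] at this
  have s23 := hV _ h23 _ hdiag
  rw [bracket_planeX_diagonal] at s23
  refine mem_of_path hV h01 h12 h23 ?_ hdiag htr hA
  -- With no Y on any edge, `s01`, `s12` and `s23` force consecutive diagonal entries to be equal.
  by_contra! hcon
  refine ha ⟨?_, ?_, ?_⟩ <;> rw [← sub_eq_zero] <;> by_contra hne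
  · exact hcon.1 ((V.smul_mem_iff hne).1 s01)
  · exact hcon.2.1 ((V.smul_mem_iff hne).1 s12)
  · exact hcon.2.2 ((V.smul_mem_iff hne).1 s23)

end LieAlgebra

/-! ### Tridiagonalisation from a cyclic vector -/

section Lanczos

variable {E : Type*} [NormedAddCommGroup E] [InnerProductSpace ℂ E]

theorem exists_pos_smul_unit {r : E} (hr : r ≠ 0) :
    ∃ b : ℝ, 0 < b ∧ ∃ e : E, ‖e‖ = 1 ∧ r = (b : ℂ) • e := by
  have h : (‖r‖ : ℂ) ≠ 0 := by simpa using hr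
  refine ⟨‖r‖, norm_pos_iff.2 hr, (‖r‖ : ℂ)⁻¹ • r, ?_,
    by rw [smul_smul, mul_inv_cancel₀ h, one_smul]⟩
  rw [norm_smul, norm_inv, Complex.norm_real, norm_norm, inv_mul_cancel₀ (by simpa using hr)]

variable {T : E →ₗ[ℂ] E} {e₀ : E}

/-- Keeps Lanczos from stopping early: a vanishing residual would make the fewer than four vectors
found so far span an invariant subspace containing e₀, hence the whole space. -/
theorem finrank_le_card_of_invariant
    (hcyc : ∀ U : Submodule ℂ E, e₀ ∈ U → (∀ u ∈ U, T u ∈ U) → U = ⊤)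
    (s : Finset E) (h0 : e₀ ∈ s) (hs : ∀ x ∈ s, T x ∈ Submodule.span ℂ (s : Set E)) :
    Module.finrank ℂ E ≤ s.card := by
  have := hcyc (Submodule.span ℂ (s : Set E)) (Submodule.subset_span h0) fun u hu =>
    (LinearMap.map_span_le T (s : Set E) _).2 hs (Submodule.mem_map_of_mem hu)
  rw [← finrank_top ℂ E, ← this]
  exact finrank_span_finset_le_card s

theorem inner_eq_zero_of_smul {b : ℝ} (hb : 0 < b) {x e r : E} (hr : r = (b : ℂ) • e)
    (h : inner ℂ x r = 0) : inner ℂ x e = 0 := by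
  rw [hr, inner_smul_right] at h
  exact (mul_eq_zero.1 h).resolve_left (by exact_mod_cast hb.ne')

/-- The Lanczos algorithm: a symmetric operator on a four-dimensional space is tridiagonal with
positive off-diagonal entries in some orthonormal basis starting with a given cyclic unit
vector. -/
theorem exists_tridiagonal (hE : Module.finrank ℂ E = 4) (hT : T.IsSymmetric) (he₀ : ‖e₀‖ = 1)
    (hcyc : ∀ U : Submodule ℂ E, e₀ ∈ U → (∀ u ∈ U, T u ∈ U) → U = ⊤) :
    ∃ e : Fin 4 → E, Orthonormal ℂ e ∧ e 0 = e₀ ∧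
      ∃ (a : Fin 4 → ℝ) (b₀ b₁ b₂ : ℝ), 0 < b₀ ∧ 0 < b₁ ∧ 0 < b₂ ∧
        T (e 0) = (a 0 : ℂ) • e 0 + (b₀ : ℂ) • e 1 ∧
        T (e 1) = (b₀ : ℂ) • e 0 + (a 1 : ℂ) • e 1 + (b₁ : ℂ) • e 2 ∧
        T (e 2) = (b₁ : ℂ) • e 1 + (a 2 : ℂ) • e 2 + (b₂ : ℂ) • e 3 ∧
        T (e 3) = (b₂ : ℂ) • e 2 + (a 3 : ℂ) • e 3 := by
  classical
  have hself : ∀ x : E, ∃ a : ℝ, inner ℂ x (T x) = (a : ℂ) := fun x =>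
    ⟨(inner ℂ (T x) x).re, by rw [← hT x x]; exact (hT.coe_re_inner_apply_self x).symm⟩
  have hone : ∀ {x : E}, ‖x‖ = 1 → inner ℂ x x = 1 := fun {x} hx => by
    rw [inner_self_eq_norm_sq_to_K, hx]; norm_num
  obtain ⟨a₀, ha₀⟩ := hself e₀
  have r₁ne : T e₀ - (a₀ : ℂ) • e₀ ≠ 0 := by
    intro h
    have := finrank_le_card_of_invariant hcyc {e₀} (by simp) (by
      simp only [Finset.mem_singleton, forall_eq, Finset.coe_singleton]
      rw [sub_eq_zero.1 h]
      exact Submodule.smul_mem _ _ (Submodule.mem_span_singleton_self _))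
    simp [hE] at this
  obtain ⟨b₀, hb₀, e₁, he₁, hr₁⟩ := exists_pos_smul_unit r₁ne
  have o01 : inner ℂ e₀ e₁ = 0 := inner_eq_zero_of_smul hb₀ hr₁ (by
    rw [inner_sub_right, inner_smul_right, hone he₀, ha₀, mul_one, sub_self])
  have T0 : T e₀ = (a₀ : ℂ) • e₀ + (b₀ : ℂ) • e₁ := by rw [← hr₁]; abel
  have o10 : inner ℂ e₁ e₀ = 0 := inner_eq_zero_symm.1 o01
  obtain ⟨a₁, ha₁⟩ := hself e₁
  have r₂ne : T e₁ - (a₁ : ℂ) • e₁ - (b₀ : ℂ) • e₀ ≠ 0 := by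
    intro h
    have h' : T e₁ = (a₁ : ℂ) • e₁ + (b₀ : ℂ) • e₀ := by
      rw [sub_sub, sub_eq_zero] at h; exact h
    have := finrank_le_card_of_invariant hcyc {e₀, e₁} (by simp) (by
      have m0 : e₀ ∈ Submodule.span ℂ (({e₀, e₁} : Finset E) : Set E) :=
        Submodule.subset_span (by simp)
      have m1 : e₁ ∈ Submodule.span ℂ (({e₀, e₁} : Finset E) : Set E) :=
        Submodule.subset_span (by simp)
      intro x hx
      rcases Finset.mem_insert.1 hx with rfl | hx
      · rw [T0]
        exact add_mem (Submodule.smul_mem _ _ m0) (Submodule.smul_mem _ _ m1)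
      · rw [Finset.mem_singleton.1 hx, h']
        exact add_mem (Submodule.smul_mem _ _ m1) (Submodule.smul_mem _ _ m0))
    have := this.trans Finset.card_le_two
    omega
  obtain ⟨b₁, hb₁, e₂, he₂, hr₂⟩ := exists_pos_smul_unit r₂ne
  have T1 : T e₁ = (b₀ : ℂ) • e₀ + (a₁ : ℂ) • e₁ + (b₁ : ℂ) • e₂ := by rw [← hr₂]; abel
  -- Symmetry moves T onto e₀, where T e₀ is already known; its e₁-coefficient b₀ cancels the
  -- subtracted term.
  have o02 : inner ℂ e₀ e₂ = 0 := inner_eq_zero_of_smul hb₁ hr₂ (by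
    rw [inner_sub_right, inner_sub_right, ← hT, T0]
    simp [-Complex.coe_smul, inner_add_left, inner_smul_left, inner_smul_right, he₀, he₁, o01])
  have o12 : inner ℂ e₁ e₂ = 0 := inner_eq_zero_of_smul hb₁ hr₂ (by
    rw [inner_sub_right, inner_sub_right, ha₁]
    simp [-Complex.coe_smul, inner_smul_right, he₁, o10])
  have o20 : inner ℂ e₂ e₀ = 0 := inner_eq_zero_symm.1 o02
  have o21 : inner ℂ e₂ e₁ = 0 := inner_eq_zero_symm.1 o12
  obtain ⟨a₂, ha₂⟩ := hself e₂
  have r₃ne : T e₂ - (a₂ : ℂ) • e₂ - (b₁ : ℂ) • e₁ ≠ 0 := by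
    intro h
    have h' : T e₂ = (a₂ : ℂ) • e₂ + (b₁ : ℂ) • e₁ := by
      rw [sub_sub, sub_eq_zero] at h; exact h
    have := finrank_le_card_of_invariant hcyc {e₀, e₁, e₂} (by simp) (by
      have m0 : e₀ ∈ Submodule.span ℂ (({e₀, e₁, e₂} : Finset E) : Set E) :=
        Submodule.subset_span (by simp)
      have m1 : e₁ ∈ Submodule.span ℂ (({e₀, e₁, e₂} : Finset E) : Set E) :=
        Submodule.subset_span (by simp)
      have m2 : e₂ ∈ Submodule.span ℂ (({e₀, e₁, e₂} : Finset E) : Set E) :=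
        Submodule.subset_span (by simp)
      intro x hx
      rcases Finset.mem_insert.1 hx with rfl | hx
      · rw [T0]
        exact add_mem (Submodule.smul_mem _ _ m0) (Submodule.smul_mem _ _ m1)
      rcases Finset.mem_insert.1 hx with rfl | hx
      · rw [T1]
        exact add_mem (add_mem (Submodule.smul_mem _ _ m0) (Submodule.smul_mem _ _ m1))
          (Submodule.smul_mem _ _ m2)
      · rw [Finset.mem_singleton.1 hx, h']
        exact add_mem (Submodule.smul_mem _ _ m2) (Submodule.smul_mem _ _ m1))
    have := this.trans Finset.card_le_three
    omega
  obtain ⟨b₂, hb₂, e₃, he₃, hr₃⟩ := exists_pos_smul_unit r₃ne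
  have T2 : T e₂ = (b₁ : ℂ) • e₁ + (a₂ : ℂ) • e₂ + (b₂ : ℂ) • e₃ := by rw [← hr₃]; abel
  have o03 : inner ℂ e₀ e₃ = 0 := inner_eq_zero_of_smul hb₂ hr₃ (by
    rw [inner_sub_right, inner_sub_right, ← hT, T0]
    simp [-Complex.coe_smul, inner_add_left, inner_smul_left, inner_smul_right, o01, o02, o12])
  have o13 : inner ℂ e₁ e₃ = 0 := inner_eq_zero_of_smul hb₂ hr₃ (by
    rw [inner_sub_right, inner_sub_right, ← hT, T1]
    simp [-Complex.coe_smul, inner_add_left, inner_smul_left, inner_smul_right, o02, o12, he₁, he₂])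
  have o23 : inner ℂ e₂ e₃ = 0 := inner_eq_zero_of_smul hb₂ hr₃ (by
    rw [inner_sub_right, inner_sub_right, ha₂]
    simp [-Complex.coe_smul, inner_smul_right, he₂, o21])
  have o30 : inner ℂ e₃ e₀ = 0 := inner_eq_zero_symm.1 o03
  have o31 : inner ℂ e₃ e₁ = 0 := inner_eq_zero_symm.1 o13
  have o32 : inner ℂ e₃ e₂ = 0 := inner_eq_zero_symm.1 o23
  have hon : Orthonormal ℂ ![e₀, e₁, e₂, e₃] := by
    rw [orthonormal_iff_ite]
    intro i j
    fin_cases i <;> fin_cases j <;> simp only [Fin.zero_eta, Fin.mk_one, Fin.reduceFinMk] <;>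
      simp [*]
  obtain ⟨a₃, ha₃⟩ := hself e₃
  -- There is no room for a fifth vector: the last residual is orthogonal to a spanning set.
  have T3 : T e₃ = (b₂ : ℂ) • e₂ + (a₃ : ℂ) • e₃ := by
    have : FiniteDimensional ℂ E := FiniteDimensional.of_finrank_pos (by omega)
    have hspan : Submodule.span ℂ (Set.range ![e₀, e₁, e₂, e₃]) = ⊤ :=
      hon.linearIndependent.span_eq_top_of_card_eq_finrank' (by simp [hE])
    rw [← sub_eq_zero]
    have hmem : ∀ x ∈ Submodule.span ℂ (Set.range ![e₀, e₁, e₂, e₃]),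
        inner ℂ x (T e₃ - ((b₂ : ℂ) • e₂ + (a₃ : ℂ) • e₃)) = 0 := by
      intro x hx
      induction hx using Submodule.span_induction with
      | mem x hx =>
        obtain ⟨i, rfl⟩ := hx
        rw [inner_sub_right]
        fin_cases i
        · change inner ℂ e₀ _ - inner ℂ e₀ _ = 0
          rw [← hT, T0]
          simp [-Complex.coe_smul, inner_add_left, inner_smul_left, o03, o13, o02]
        · change inner ℂ e₁ _ - inner ℂ e₁ _ = 0
          rw [← hT, T1]
          simp [-Complex.coe_smul, inner_add_left, inner_smul_left, o03, o13, o23,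
            o12]
        · change inner ℂ e₂ _ - inner ℂ e₂ _ = 0
          rw [← hT, T2]
          simp [-Complex.coe_smul, inner_add_left, inner_smul_left, o13, o23,
            he₂, he₃]
        · change inner ℂ e₃ _ - inner ℂ e₃ _ = 0
          rw [ha₃]
          simp [-Complex.coe_smul, o32, he₃]
      | zero => simp
      | add x y _ _ hx hy => rw [inner_add_left, hx, hy, add_zero]
      | smul c x _ hx => rw [inner_smul_left, hx, mul_zero]
    exact inner_self_eq_zero.1 (hmem _ (hspan ▸ Submodule.mem_top))
  exact ⟨![e₀, e₁, e₂, e₃], hon, rfl, ![a₀, a₁, a₂, a₃], b₀, b₁, b₂, hb₀, hb₁, hb₂, T0, T1, T2, T3⟩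

/-- A symmetric operator with no eigenvector orthogonal to `e₀` has `e₀` as a cyclic vector. -/
theorem eq_top_of_invariant [FiniteDimensional ℂ E] (hT : T.IsSymmetric)
    (h : ∀ v : E, v ≠ 0 → inner ℂ e₀ v = 0 → ∀ μ : ℂ, T v ≠ μ • v)
    (U : Submodule ℂ E) (h0 : e₀ ∈ U) (hU : ∀ u ∈ U, T u ∈ U) : U = ⊤ := by
  by_contra hne
  -- By symmetry Uᗮ is invariant too; if nonzero it contains an eigenvector, which is orthogonal to
  -- e₀ ∈ U.
  have hperp : ∀ v ∈ Uᗮ, T v ∈ Uᗮ := by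
    intro v hv u hu
    rw [← hT]
    exact hv _ (hU u hu)
  have : Nontrivial Uᗮ := by
    rw [Submodule.nontrivial_iff_ne_bot]
    exact fun hb => hne ((Submodule.orthogonal_eq_bot_iff).1 hb)
  obtain ⟨μ, hμ⟩ := Module.End.exists_eigenvalue (T.restrict hperp)
  obtain ⟨v, hv⟩ := hμ.exists_hasEigenvector
  refine h v (by simpa using hv.2) (v.2 _ h0) μ ?_
  simpa using congrArg Subtype.val hv.apply_eq_smul

end Lanczos

/-! ### The three obstructions to universality -/

section Obstructions

variable {n : Type*} [Fintype n] [DecidableEq n]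

theorem evolution_mem_subalgebra (s : Subalgebra ℂ (Matrix n n ℂ)) {H : Matrix n n ℂ}
    (hH : H ∈ s) (t : ℝ) : evolution H t ∈ s :=
  NormedSpace.exp_mem (R := ℂ) (s := s) (Submodule.closed_of_finiteDimensional s.toSubmodule)
    (s.smul_mem hH _)

/-- The matrices that have `v` as an eigenvector. -/
def eigenvectorSubalgebra (v : n → ℂ) : Subalgebra ℂ (Matrix n n ℂ) where
  carrier := {A | ∃ c : ℂ, A.mulVec v = c • v}
  mul_mem' := by
    rintro A B ⟨a, ha⟩ ⟨b, hb⟩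
    exact ⟨b * a, by rw [← Matrix.mulVec_mulVec, hb, Matrix.mulVec_smul, ha, smul_smul]⟩
  add_mem' := by
    rintro A B ⟨a, ha⟩ ⟨b, hb⟩
    exact ⟨a + b, by rw [Matrix.add_mulVec, ha, hb, add_smul]⟩
  algebraMap_mem' c := ⟨c, by simp [Algebra.algebraMap_eq_smul_one, Matrix.smul_mulVec]⟩

theorem diagonal_reflection_mem_unitaryGroup (i : n) :
    Matrix.diagonal (fun k => if k = i then -1 else 1) ∈ Matrix.unitaryGroup n ℂ := by
  rw [Matrix.mem_unitaryGroup_iff, Matrix.star_eq_conjTranspose, Matrix.diagonal_conjTranspose,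
    Matrix.diagonal_mul_diagonal, ← Matrix.diagonal_one]
  congr 1
  ext k
  by_cases hk : k = i <;> simp [hk]

/-- If v_i ≠ 0, being an eigenvector of the reflection in coordinate i forces every other coordinate
to vanish, and then the transposition of i and j moves v off its line. -/
theorem exists_unitary_not_mem_eigenvectorSubalgebra [Nontrivial n] {v : n → ℂ} (hv : v ≠ 0) :
    ∃ U ∈ Matrix.unitaryGroup n ℂ, U ∉ eigenvectorSubalgebra v := by
  by_contra! h
  obtain ⟨i, hi⟩ : ∃ i, v i ≠ 0 := Function.ne_iff.1 hv
  obtain ⟨j, hj⟩ := exists_ne i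
  obtain ⟨c, hc⟩ := h (Matrix.diagonal fun k => if k = i then -1 else 1)
    (diagonal_reflection_mem_unitaryGroup i)
  have hci := congrFun hc i
  have hcj := congrFun hc j
  simp only [Matrix.mulVec_diagonal, Pi.smul_apply, smul_eq_mul, if_true, if_neg hj, one_mul]
    at hci hcj
  have hc1 : c = -1 := (mul_right_cancel₀ hi hci).symm
  have hvj : v j = 0 := by
    rw [hc1] at hcj
    linear_combination hcj / 2
  obtain ⟨d, hd⟩ := h ((Equiv.swap i j).permMatrix ℂ) (by
    rw [Matrix.mem_unitaryGroup_iff, Matrix.star_eq_conjTranspose, Matrix.conjTranspose_permMatrix,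
      ← Matrix.permMatrix_mul]
    simp)
  have hdj := congrFun hd j
  rw [Matrix.permMatrix_mulVec] at hdj
  simp [hvj, hi] at hdj

/-- The determinant is exp(-it tr H), read off after diagonalising H. -/
theorem det_evolution_of_trace_eq_zero {H : Matrix n n ℂ} (hH : H.IsHermitian)
    (htr : H.trace = 0) (t : ℝ) : (evolution H t).det = 1 := by
  have hU := hH.eigenvectorUnitary.2
  have h := hH.spectral_theorem
  rw [Unitary.conjStarAlgAut_apply] at h
  rw [h]
  change (evolution ((hH.eigenvectorUnitary : Matrix n n ℂ) * _ * star
    (hH.eigenvectorUnitary : Matrix n n ℂ)) t).det = 1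
  rw [evolution_conj hU, Matrix.det_mul_comm, ← mul_assoc, Matrix.mem_unitaryGroup_iff'.1 hU,
    one_mul, evolution, ← Matrix.diagonal_smul, Matrix.exp_diagonal, Matrix.det_diagonal]
  simp only [Pi.coe_exp, ← Complex.exp_eq_exp_ℂ]
  rw [← Complex.exp_sum]
  simp only [Pi.smul_apply, smul_eq_mul, Function.comp_apply]
  rw [← Finset.mul_sum]
  have := hH.trace_eq_sum_eigenvalues
  rw [htr] at this
  rw [show ∑ i, (RCLike.ofReal (hH.eigenvalues i) : ℂ) = 0 from this.symm, mul_zero,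
    Complex.exp_zero]

theorem exists_unitary_det_ne_one [Nonempty n] :
    ∃ U ∈ Matrix.unitaryGroup n ℂ, U.det ≠ 1 := by
  obtain ⟨i⟩ := ‹Nonempty n›
  refine ⟨_, diagonal_reflection_mem_unitaryGroup i, ?_⟩
  rw [Matrix.det_diagonal, Finset.prod_ite_eq' Finset.univ i]
  norm_num

variable {m : Type*} [Fintype m] [DecidableEq m]

/-- The product operators `A ⊗ B`. -/
noncomputable def productMonoid (m n : Type*) [Fintype m] [DecidableEq m] [Fintype n]
    [DecidableEq n] : Submonoid (Matrix (m × n) (m × n) ℂ) where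
  carrier := {M | ∃ (A : Matrix m m ℂ) (B : Matrix n n ℂ), M = A ⊗ₖ B}
  one_mem' := ⟨1, 1, Matrix.one_kronecker_one.symm⟩
  mul_mem' := by
    rintro _ _ ⟨A, B, rfl⟩ ⟨C, D, rfl⟩
    exact ⟨A * C, B * D, (Matrix.mul_kronecker_mul A C B D).symm⟩

/-- With rows indexed by (a, c) and columns by (b, d), a product operator is a matrix of rank at
most one, i.e. all 2 × 2 minors vanish. These polynomial equations show that the product operators
form a closed set. -/
theorem mem_productMonoid_iff {M : Matrix (m × n) (m × n) ℂ} :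
    M ∈ productMonoid m n ↔ ∀ a b c d a' b' c' d',
      M (a, b) (c, d) * M (a', b') (c', d') = M (a, b') (c, d') * M (a', b) (c', d) := by
  constructor
  · rintro ⟨A, B, rfl⟩ a b c d a' b' c' d'
    simp only [Matrix.kroneckerMap_apply]
    ring
  · intro h
    by_cases hM : M = 0
    · exact ⟨0, 0, by simp [hM]⟩
    obtain ⟨⟨a₀, b₀⟩, ⟨c₀, d₀⟩, h0⟩ : ∃ p q, M p q ≠ 0 := by
      by_contra! h0
      exact hM (Matrix.ext h0)
    refine ⟨Matrix.of fun a c => M (a, b₀) (c, d₀),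
      Matrix.of fun b d => M (a₀, b) (c₀, d) / M (a₀, b₀) (c₀, d₀), ?_⟩
    ext ⟨a, b⟩ ⟨c, d⟩
    simp only [Matrix.kroneckerMap_apply, Matrix.of_apply]
    rw [← mul_div_assoc, eq_div_iff h0]
    exact h _ _ _ _ _ _ _ _

theorem isClosed_productMonoid :
    IsClosed (productMonoid m n : Set (Matrix (m × n) (m × n) ℂ)) := by
  have : (productMonoid m n : Set (Matrix (m × n) (m × n) ℂ)) =
      {M | ∀ a b c d a' b' c' d',
        M (a, b) (c, d) * M (a', b') (c', d') = M (a, b') (c, d') * M (a', b) (c', d)} :=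
    Set.ext fun _ => mem_productMonoid_iff
  rw [this]
  simp only [Set.ofPred_forall]
  refine isClosed_iInter fun a => isClosed_iInter fun b => isClosed_iInter fun c =>
    isClosed_iInter fun d => isClosed_iInter fun a' => isClosed_iInter fun b' =>
    isClosed_iInter fun c' => isClosed_iInter fun d' => isClosed_eq ?_ ?_ <;> fun_prop

theorem evolution_kronecker_one (A : Matrix m m ℂ) (t : ℝ) :
    evolution (A ⊗ₖ (1 : Matrix n n ℂ)) t = evolution A t ⊗ₖ (1 : Matrix n n ℂ) := by
  let f : Matrix m m ℂ →+* Matrix (m × n) (m × n) ℂ :=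
    { toFun := fun A => A ⊗ₖ (1 : Matrix n n ℂ)
      map_one' := Matrix.one_kronecker_one
      map_mul' := fun A B => by rw [← Matrix.mul_kronecker_mul, one_mul]
      map_zero' := Matrix.zero_kronecker _
      map_add' := fun A B => Matrix.add_kronecker _ _ _ }
  have hf : Continuous f := by
    refine continuous_matrix fun i j => ?_
    simp only [f, RingHom.coe_mk, MonoidHom.coe_mk, OneHom.coe_mk, Matrix.kroneckerMap_apply]
    fun_prop
  have h : f (NormedSpace.exp ((-(Complex.I * (t : ℂ))) • A)) =
      NormedSpace.exp (f ((-(Complex.I * (t : ℂ))) • A)) := by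
    open scoped Matrix.Norms.L2Operator in
    let : NormedAlgebra ℚ (Matrix m m ℂ) := NormedAlgebra.restrictScalars ℚ ℂ _
    exact NormedSpace.map_exp f hf _
  rw [evolution, ← Matrix.smul_kronecker]
  exact h.symm

theorem evolution_one_kronecker (B : Matrix n n ℂ) (t : ℝ) :
    evolution ((1 : Matrix m m ℂ) ⊗ₖ B) t = (1 : Matrix m m ℂ) ⊗ₖ evolution B t := by
  let f : Matrix n n ℂ →+* Matrix (m × n) (m × n) ℂ :=
    { toFun := fun B => (1 : Matrix m m ℂ) ⊗ₖ B
      map_one' := Matrix.one_kronecker_one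
      map_mul' := fun A B => by rw [← Matrix.mul_kronecker_mul, one_mul]
      map_zero' := Matrix.kronecker_zero _
      map_add' := fun A B => Matrix.kronecker_add _ _ _ }
  have hf : Continuous f := by
    refine continuous_matrix fun i j => ?_
    simp only [f, RingHom.coe_mk, MonoidHom.coe_mk, OneHom.coe_mk, Matrix.kroneckerMap_apply]
    fun_prop
  have h : f (NormedSpace.exp ((-(Complex.I * (t : ℂ))) • B)) =
      NormedSpace.exp (f ((-(Complex.I * (t : ℂ))) • B)) := by
    open scoped Matrix.Norms.L2Operator in
    let : NormedAlgebra ℚ (Matrix n n ℂ) := NormedAlgebra.restrictScalars ℚ ℂ _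
    exact NormedSpace.map_exp f hf _
  rw [evolution, ← Matrix.kronecker_smul]
  exact h.symm

/-- The two local terms commute, so the exponential splits into one factor per qubit. -/
theorem evolution_add_mem_productMonoid (A : Matrix m m ℂ) (B : Matrix n n ℂ) (t : ℝ) :
    evolution (A ⊗ₖ (1 : Matrix n n ℂ) + (1 : Matrix m m ℂ) ⊗ₖ B) t ∈ productMonoid m n := by
  have hc : Commute (A ⊗ₖ (1 : Matrix n n ℂ)) ((1 : Matrix m m ℂ) ⊗ₖ B) := by
    rw [Commute, SemiconjBy, ← Matrix.mul_kronecker_mul, ← Matrix.mul_kronecker_mul]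
    simp
  rw [evolution, smul_add, Matrix.exp_add_of_commute _ _ ((hc.smul_left _).smul_right _)]
  change evolution _ t * evolution _ t ∈ _
  rw [evolution_kronecker_one, evolution_one_kronecker]
  exact mul_mem ⟨_, _, rfl⟩ ⟨_, _, rfl⟩

/-! ### The swap gate and the failure of universality -/

theorem swapGate_mul_apply {ι : Type*} (M : Matrix (Fin 2 × Fin 2) ι ℂ) (i : Fin 2 × Fin 2)
    (j : ι) :
    (swapGate * M) i j = M i.swap j := by
  rw [Matrix.mul_apply, Finset.sum_eq_single i.swap]
  · simp [swapGate]
  · intro k _ hk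
    rw [swapGate, Matrix.of_apply, if_neg, zero_mul]
    rintro rfl
    simp at hk
  · simp

theorem mul_swapGate_apply (M : TwoQubitMatrix) (i j : Fin 2 × Fin 2) :
    (M * swapGate) i j = M i j.swap := by
  rw [Matrix.mul_apply, Finset.sum_eq_single j.swap]
  · simp [swapGate]
  · intro k _ hk
    rw [swapGate, Matrix.of_apply, if_neg hk, mul_zero]
  · simp

theorem swapGate_mul_swapGate : swapGate * swapGate = 1 := by
  ext i j
  rw [swapGate_mul_apply, swapGate, Matrix.of_apply, Matrix.one_apply]
  simp [Prod.swap_inj]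

theorem swapGate_isHermitian : swapGate.IsHermitian := by
  ext i j
  simp only [swapGate, Matrix.conjTranspose_apply, Matrix.of_apply]
  rcases i with ⟨a, b⟩
  rcases j with ⟨c, d⟩
  simp only [Prod.swap_prod_mk, Prod.mk.injEq, apply_ite star, star_one, star_zero]
  grind

theorem isHermitian_of_mem_pair {H : TwoQubitMatrix} (hH : H.IsHermitian) :
    ∀ A ∈ ({H, swapGate * H * swapGate} : Set TwoQubitMatrix), A.IsHermitian := by
  rintro A (rfl | rfl)
  · exact hH
  · have := Matrix.isHermitian_mul_mul_conjTranspose swapGate hH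
    rwa [swapGate_isHermitian.eq] at this

theorem not_isTwoUniversal_of_le {H : TwoQubitMatrix} {M : Submonoid TwoQubitMatrix}
    (hM : IsClosed (M : Set TwoQubitMatrix))
    (h : ∀ A ∈ ({H, swapGate * H * swapGate} : Set TwoQubitMatrix), ∀ t : ℝ, evolution A t ∈ M)
    (hne : ∃ U ∈ Matrix.unitaryGroup (Fin 2 × Fin 2) ℂ, U ∉ M) : ¬ IsTwoUniversal H := by
  obtain ⟨U, hU, hUM⟩ := hne
  exact fun huniv => hUM (simulationMonoid_le hM h (canSimulate_iff.1 (huniv U hU)))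

theorem not_isTwoUniversal_of_trace_eq_zero {H : TwoQubitMatrix} (hH : H.IsHermitian)
    (htr : H.trace = 0) : ¬ IsTwoUniversal H := by
  refine not_isTwoUniversal_of_le (M := MonoidHom.mker (Matrix.detMonoidHom (R := ℂ))) ?_ ?_ ?_
  · exact isClosed_eq (f := fun M : TwoQubitMatrix => M.det) (by fun_prop) continuous_const
  · intro A hA t
    refine det_evolution_of_trace_eq_zero (isHermitian_of_mem_pair hH A hA) ?_ t
    rcases hA with rfl | rfl
    · exact htr
    · rw [mul_assoc, Matrix.trace_mul_comm, mul_assoc, swapGate_mul_swapGate, mul_one, htr]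
  · exact exists_unitary_det_ne_one

theorem not_isTwoUniversal_of_shareEigenvector {H : TwoQubitMatrix}
    (h : ShareEigenvector H swapGate) : ¬ IsTwoUniversal H := by
  obtain ⟨v, hv, hHv, hTv⟩ := h
  refine not_isTwoUniversal_of_le (M := (eigenvectorSubalgebra v).toSubmonoid)
    (Submodule.closed_of_finiteDimensional (eigenvectorSubalgebra v).toSubmodule) ?_
    (exists_unitary_not_mem_eigenvectorSubalgebra hv)
  intro A hA t
  refine evolution_mem_subalgebra (eigenvectorSubalgebra v) ?_ t
  rcases hA with rfl | rfl
  · exact hHv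
  · exact mul_mem (mul_mem hTv hHv) hTv

/-- Since P commutes with T, conjugation by P turns THT into TLT, which is L with its two one-qubit
terms exchanged and so again local. -/
theorem not_isTwoUniversal_of_tSimilar_local {H L : TwoQubitMatrix} (hL : IsLocalHamiltonian L)
    (h : TSimilar H L) : ¬ IsTwoUniversal H := by
  obtain ⟨H₁, H₂, -, -, hL⟩ := hL
  obtain ⟨P, hP, hPT, hLP⟩ := h
  have hP1 := Matrix.mem_unitaryGroup_iff.1 hP
  have hP2 := Matrix.mem_unitaryGroup_iff'.1 hP
  have hPT' : Commute (star P) swapGate := by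
    have := congrArg star hPT.eq
    simp only [star_mul, Matrix.star_eq_conjTranspose, swapGate_isHermitian.eq] at this
    exact this.symm
  let M : Submonoid TwoQubitMatrix :=
    { carrier := {U | P * U * star P ∈ productMonoid (Fin 2) (Fin 2)}
      one_mem' := by
        change P * 1 * star P ∈ productMonoid (Fin 2) (Fin 2)
        rw [mul_one, hP1]
        exact one_mem _
      mul_mem' := by
        intro U V hU hV
        have : P * (U * V) * star P = (P * U * star P) * (P * V * star P) := by
          calc P * (U * V) * star P = P * U * 1 * V * star P := by simp only [mul_one, mul_assoc]
            _ = _ := by rw [← hP2]; simp only [mul_assoc]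
        change P * (U * V) * star P ∈ productMonoid (Fin 2) (Fin 2)
        rw [this]
        exact mul_mem hU hV }
  refine not_isTwoUniversal_of_le (M := M) ?_ ?_ ?_
  · exact isClosed_productMonoid.preimage
      (f := fun U : TwoQubitMatrix => P * U * star P) (by fun_prop)
  · intro A hA t
    change P * evolution A t * star P ∈ productMonoid (Fin 2) (Fin 2)
    rw [← evolution_conj hP]
    rcases hA with rfl | rfl
    · rw [Matrix.star_eq_conjTranspose, ← hLP, hL]
      exact evolution_add_mem_productMonoid _ _ _
    · have : P * (swapGate * H * swapGate) * star P = swapGate * L * swapGate := by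
        rw [hLP, ← Matrix.star_eq_conjTranspose]
        calc P * (swapGate * H * swapGate) * star P
            = (P * swapGate) * H * (swapGate * star P) := by simp only [mul_assoc]
          _ = _ := by rw [hPT.eq, ← hPT'.eq]; simp only [mul_assoc]
      rw [this, show swapGate * L * swapGate = H₂ ⊗ₖ (1 : Matrix (Fin 2) (Fin 2) ℂ) +
        (1 : Matrix (Fin 2) (Fin 2) ℂ) ⊗ₖ H₁ from ?_]
      · exact evolution_add_mem_productMonoid _ _ _
      · ext ⟨a, b⟩ ⟨c, d⟩
        rw [mul_swapGate_apply, swapGate_mul_apply, hL]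
        simp only [Prod.swap_prod_mk, Matrix.add_apply, Matrix.kroneckerMap_apply]
        ring
  -- The controlled-Z gate is not a product: its diagonal 1, 1, 1, -1 violates a 2 × 2 minor
  -- condition. Pulling it back through P gives the missing unitary.
  · let D : TwoQubitMatrix := Matrix.diagonal fun k => if k = (1, 1) then -1 else 1
    have hD : D ∈ Matrix.unitaryGroup (Fin 2 × Fin 2) ℂ :=
      diagonal_reflection_mem_unitaryGroup (1, 1)
    refine ⟨star P * D * P, mul_mem (mul_mem (Unitary.star_mem hP) hD) hP, ?_⟩
    intro hmem
    change P * (star P * D * P) * star P ∈ productMonoid (Fin 2) (Fin 2) at hmem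
    have : P * (star P * D * P) * star P = D := by
      calc P * (star P * D * P) * star P = (P * star P) * D * (P * star P) := by
            simp only [mul_assoc]
        _ = D := by rw [hP1, one_mul, mul_one]
    rw [this, mem_productMonoid_iff] at hmem
    have := hmem 0 0 0 0 1 1 1 1
    simp [D] at this
    norm_num at this

end Obstructions

/-! ### The singlet basis and the proof of universality -/

section Universality

/-- The real number `1 / √2`, as a complex number. -/
noncomputable def invSqrtTwo : ℂ := ((√2)⁻¹ : ℝ)

theorem invSqrtTwo_mul_self : invSqrtTwo * invSqrtTwo = 1 / 2 := by
  rw [invSqrtTwo, ← Complex.ofReal_mul, ← mul_inv, Real.mul_self_sqrt (by norm_num)]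
  norm_num

theorem star_invSqrtTwo : star invSqrtTwo = invSqrtTwo := Complex.conj_ofReal _

/-- The matrix whose columns are the Bell states `Ψ⁻, Ψ⁺, Φ⁺, Φ⁻`. -/
noncomputable def bellMatrix : Matrix (Fin 2 × Fin 2) (Fin 4) ℂ :=
  Matrix.of fun p k => invSqrtTwo *
    ![![![0, 0, 1, 1], ![1, 1, 0, 0]], ![![-1, 1, 0, 0], ![0, 0, 1, -1]]] p.1 p.2 k

theorem bellMatrix_conjTranspose_mul : bellMatrix.conjTranspose * bellMatrix = 1 := by
  ext j k
  rw [Matrix.mul_apply, Fintype.sum_prod_type]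
  simp only [Fin.sum_univ_two, Matrix.conjTranspose_apply, bellMatrix, Matrix.of_apply, star_mul',
    star_invSqrtTwo]
  have h := invSqrtTwo_mul_self
  fin_cases j <;> fin_cases k <;> simp <;> linear_combination (2 : ℂ) * h

/-- The eigenvalues of the swap gate on the Bell states. -/
def swapSign : Fin 4 → ℂ := ![-1, 1, 1, 1]

theorem swapGate_mul_bellMatrix :
    swapGate * bellMatrix = bellMatrix * Matrix.diagonal swapSign := by
  ext ⟨i, j⟩ k
  rw [swapGate_mul_apply, Matrix.mul_diagonal]
  fin_cases i <;> fin_cases j <;> fin_cases k <;> simp [bellMatrix, swapSign]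

theorem mul_conjTranspose_eq_one {B : Matrix (Fin 2 × Fin 2) (Fin 4) ℂ}
    (hB : B.conjTranspose * B = 1) : B * B.conjTranspose = 1 :=
  (Matrix.mul_eq_one_comm_of_card_eq (Fin 2 × Fin 2) (Fin 4) ℂ (by simp)).2 hB

/-- The tridiagonal Hamiltonian with diagonal `a` and off-diagonal entries `b₀, b₁, b₂`. -/
noncomputable def tridiagonal (a : Fin 4 → ℝ) (b₀ b₁ b₂ : ℝ) : Matrix (Fin 4) (Fin 4) ℂ :=
  Matrix.diagonal (fun i => (a i : ℂ)) + b₁ • planeX 1 2 + b₂ • planeX 2 3 + b₀ • planeX 0 1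

/-- Take L = c + b₀(Z₁ - Z₂)/2 + b₁(X₁ + X₂)/2 + b₂(Z₁ + Z₂)/2. The last three operators exchange Ψ⁻
with Ψ⁺, Ψ⁺ with Φ⁺ and Φ⁺ with Φ⁻ respectively, and each kills the other two Bell states. -/
theorem exists_local_mul_bellMatrix (c b₀ b₁ b₂ : ℝ) :
    ∃ L : TwoQubitMatrix, IsLocalHamiltonian L ∧
      L * bellMatrix = bellMatrix * tridiagonal (fun _ => c) b₀ b₁ b₂ := by
  refine ⟨_, ⟨!![((c + b₀ + b₂) / 2 : ℂ), b₁ / 2; b₁ / 2, (c - b₀ - b₂) / 2],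
    !![((c - b₀ + b₂) / 2 : ℂ), b₁ / 2; b₁ / 2, (c + b₀ - b₂) / 2], ?_, ?_, rfl⟩, ?_⟩
  · ext i j
    fin_cases i <;> fin_cases j <;> simp
  · ext i j
    fin_cases i <;> fin_cases j <;> simp
  · ext ⟨i, j⟩ k
    rw [Matrix.mul_apply, Fintype.sum_prod_type, Matrix.mul_apply]
    simp only [Fin.sum_univ_two, Fin.sum_univ_four, Matrix.add_apply, Matrix.kroneckerMap_apply,
      bellMatrix, tridiagonal, planeX, Matrix.smul_apply, Matrix.single_apply, Matrix.of_apply,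
      Matrix.diagonal_apply, Matrix.one_apply]
    fin_cases i <;> fin_cases j <;> fin_cases k <;> simp <;> ring

theorem inner_eq_sum (v w : EuclideanSpace ℂ (Fin 2 × Fin 2)) :
    inner ℂ v w = ∑ p, star (v p) * w p := by
  rw [PiLp.inner_apply]
  exact Finset.sum_congr rfl fun p _ => mul_comm _ _

/-- The singlet state. -/
noncomputable def singlet : EuclideanSpace ℂ (Fin 2 × Fin 2) :=
  WithLp.toLp 2 fun p => bellMatrix p 0

theorem norm_singlet : ‖singlet‖ = 1 := by
  have h : inner ℂ singlet singlet = 1 := by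
    have := congrFun (congrFun bellMatrix_conjTranspose_mul 0) 0
    rw [Matrix.mul_apply] at this
    rw [inner_eq_sum]
    simpa [singlet] using this
  have h' : ‖singlet‖ ^ 2 = 1 := by
    rw [← inner_self_eq_norm_sq (𝕜 := ℂ), h]
    exact RCLike.one_re
  exact (pow_eq_one_iff_of_nonneg (norm_nonneg _) two_ne_zero).1 h'

theorem apply_swap_of_inner_singlet_eq_zero {v : EuclideanSpace ℂ (Fin 2 × Fin 2)}
    (hv : inner ℂ singlet v = 0) (p : Fin 2 × Fin 2) : v p.swap = v p := by
  have h : v (0, 1) = v (1, 0) := by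
    rw [inner_eq_sum, Fintype.sum_prod_type] at hv
    simp only [Fin.sum_univ_two, singlet, bellMatrix, Matrix.of_apply, star_mul',
      star_invSqrtTwo] at hv
    simp only [Matrix.cons_val_zero, Matrix.cons_val_one, star_zero, star_one, star_neg] at hv
    linear_combination 2 * invSqrtTwo * hv - 2 * (v (0, 1) - v (1, 0)) * invSqrtTwo_mul_self
  rcases p with ⟨i, j⟩
  fin_cases i <;> fin_cases j <;> simp [h]

/-- Every vector orthogonal to the singlet is fixed by T, so H has no eigenvector there and the
singlet is cyclic. For the same reason any orthonormal basis starting with the singlet diagonalises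
T. -/
theorem exists_tridiagonal_basis {H : TwoQubitMatrix} (hH : H.IsHermitian)
    (hE : ¬ ShareEigenvector H swapGate) :
    ∃ B : Matrix (Fin 2 × Fin 2) (Fin 4) ℂ, B.conjTranspose * B = 1 ∧
      swapGate * B = B * Matrix.diagonal swapSign ∧
      ∃ (a : Fin 4 → ℝ) (b₀ b₁ b₂ : ℝ), 0 < b₀ ∧ 0 < b₁ ∧ 0 < b₂ ∧
        H * B = B * tridiagonal a b₀ b₁ b₂ := by
  have hT : (Matrix.toEuclideanLin H).IsSymmetric := Matrix.isSymmetric_toEuclideanLin_iff.2 hH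
  have hne : ∀ v : EuclideanSpace ℂ (Fin 2 × Fin 2), v ≠ 0 → inner ℂ singlet v = 0 →
      ∀ μ : ℂ, Matrix.toEuclideanLin H v ≠ μ • v := by
    intro v hv hs μ hμ
    refine hE ⟨v.ofLp, fun h => hv (by ext p; exact congrFun h p), ⟨μ, ?_⟩, 1, ?_⟩
    · exact congrArg WithLp.ofLp hμ
    · ext p
      rw [Matrix.mulVec_eq_sum, one_smul]
      have := swapGate_mul_apply (Matrix.of fun p _ => v p) p (0, 0)
      rw [Matrix.mul_apply] at this
      simp only [Matrix.of_apply, apply_swap_of_inner_singlet_eq_zero hs] at this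
      rw [← this]
      simp [mul_comm]
  obtain ⟨e, he, he0, a, b₀, b₁, b₂, hb₀, hb₁, hb₂, h0, h1, h2, h3⟩ :=
    exists_tridiagonal (by simp) hT norm_singlet (eq_top_of_invariant hT hne)
  refine ⟨Matrix.of fun p k => e k p, ?_, ?_, a, b₀, b₁, b₂, hb₀, hb₁, hb₂, ?_⟩
  · ext j k
    rw [Matrix.mul_apply]
    have := orthonormal_iff_ite.1 he j k
    rw [inner_eq_sum] at this
    simpa [Matrix.one_apply] using this
  · ext p k
    rw [swapGate_mul_apply, Matrix.mul_diagonal]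
    simp only [Matrix.of_apply]
    by_cases hk : k = 0
    · subst hk
      have := congrFun (congrFun swapGate_mul_bellMatrix p) 0
      rw [swapGate_mul_apply, Matrix.mul_diagonal] at this
      rw [he0]
      exact this
    · have hs : inner ℂ singlet (e k) = 0 := by
        rw [← he0]
        exact he.2 (Ne.symm hk)
      rw [apply_swap_of_inner_singlet_eq_zero hs]
      fin_cases k <;> simp_all [swapSign]
  · ext p k
    have hcol : (H * Matrix.of fun p k => e k p) p k = Matrix.toEuclideanLin H (e k) p := rfl
    rw [hcol, Matrix.mul_apply]
    fin_cases k
    · change Matrix.toEuclideanLin H (e 0) p = _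
      rw [h0]
      simp [Fin.sum_univ_four, tridiagonal, planeX]
      ring
    · change Matrix.toEuclideanLin H (e 1) p = _
      rw [h1]
      simp [Fin.sum_univ_four, tridiagonal, planeX]
      ring
    · change Matrix.toEuclideanLin H (e 2) p = _
      rw [h2]
      simp [Fin.sum_univ_four, tridiagonal, planeX]
      ring
    · change Matrix.toEuclideanLin H (e 3) p = _
      rw [h3]
      simp [Fin.sum_univ_four, tridiagonal, planeX]
      ring

/-- Conjugation `X ↦ B X B†` as a real linear map. -/
noncomputable def conjLinearMap {m n : Type*} [Fintype m] [Fintype n] (B : Matrix m n ℂ) :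
    Matrix n n ℂ →ₗ[ℝ] Matrix m m ℂ where
  toFun X := B * X * B.conjTranspose
  map_add' X Y := by rw [Matrix.mul_add, Matrix.add_mul]
  map_smul' r X := by simp

theorem conjLinearMap_apply {m n : Type*} [Fintype m] [Fintype n] (B : Matrix m n ℂ)
    (X : Matrix n n ℂ) : conjLinearMap B X = B * X * B.conjTranspose := rfl

theorem conjLinearMap_hermitianBracket {m n : Type*} [Fintype m] [Fintype n] [DecidableEq m]
    [DecidableEq n] {B : Matrix m n ℂ} (hB : B.conjTranspose * B = 1) (X Y : Matrix n n ℂ) :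
    conjLinearMap B (hermitianBracket X Y) =
      Complex.I • (conjLinearMap B X * conjLinearMap B Y -
        conjLinearMap B Y * conjLinearMap B X) := by
  have h : ∀ X Y, conjLinearMap B X * conjLinearMap B Y = B * (X * Y) * B.conjTranspose := by
    intro X Y
    calc conjLinearMap B X * conjLinearMap B Y
        = B * X * (B.conjTranspose * B) * Y * B.conjTranspose := by
          simp only [conjLinearMap_apply, Matrix.mul_assoc]
      _ = _ := by rw [hB, Matrix.mul_one, Matrix.mul_assoc B X Y]
  rw [h, h, conjLinearMap_apply, hermitianBracket, ← Matrix.sub_mul, ← Matrix.mul_sub]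
  simp

/-- Only entries linking index 0 to another index change sign, and b₀ is the only such off-diagonal
parameter. -/
theorem diagonal_swapSign_mul_tridiagonal_mul (a : Fin 4 → ℝ) (b₀ b₁ b₂ : ℝ) :
    Matrix.diagonal swapSign * tridiagonal a b₀ b₁ b₂ * Matrix.diagonal swapSign =
      tridiagonal a (-b₀) b₁ b₂ := by
  ext j k
  rw [Matrix.mul_diagonal, Matrix.diagonal_mul]
  fin_cases j <;> fin_cases k <;> simp [swapSign, tridiagonal, planeX]

theorem trace_tridiagonal (a : Fin 4 → ℝ) (b₀ b₁ b₂ : ℝ) :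
    (tridiagonal a b₀ b₁ b₂).trace = ((∑ i, a i : ℝ) : ℂ) := by
  simp [Matrix.trace, Fin.sum_univ_four, tridiagonal, planeX]

/-- The change of basis R B† commutes with T because both bases list T-eigenvectors with the same
signs in the same order. -/
theorem tSimilar_of_mul_eq {H L : TwoQubitMatrix} {B R : Matrix (Fin 2 × Fin 2) (Fin 4) ℂ}
    {J : Matrix (Fin 4) (Fin 4) ℂ} (hB : B.conjTranspose * B = 1) (hR : R.conjTranspose * R = 1)
    (hTB : swapGate * B = B * Matrix.diagonal swapSign)
    (hTR : swapGate * R = R * Matrix.diagonal swapSign)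
    (hHB : H * B = B * J) (hLR : L * R = R * J) : TSimilar H L := by
  have hR' := mul_conjTranspose_eq_one hR
  have hTB' : B.conjTranspose * swapGate = Matrix.diagonal swapSign * B.conjTranspose := by
    have := congrArg Matrix.conjTranspose hTB
    rw [Matrix.conjTranspose_mul, Matrix.conjTranspose_mul, swapGate_isHermitian.eq,
      Matrix.diagonal_conjTranspose] at this
    rw [this]
    congr 2
    ext k
    fin_cases k <;> simp [swapSign]
  refine ⟨R * B.conjTranspose, ?_, ?_, ?_⟩
  · rw [Matrix.mem_unitaryGroup_iff, Matrix.star_eq_conjTranspose, Matrix.conjTranspose_mul,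
      Matrix.conjTranspose_conjTranspose, Matrix.mul_assoc, ← Matrix.mul_assoc _ B, hB,
      Matrix.one_mul, hR']
  · rw [Commute, SemiconjBy, Matrix.mul_assoc, hTB', ← Matrix.mul_assoc, ← hTR, Matrix.mul_assoc]
  · calc L = L * R * R.conjTranspose := by rw [Matrix.mul_assoc, hR', Matrix.mul_one]
      _ = R * (B.conjTranspose * B) * J * R.conjTranspose := by rw [hLR, hB, Matrix.mul_one]
      _ = R * B.conjTranspose * (B * J) * R.conjTranspose := by simp only [Matrix.mul_assoc]
      _ = _ := by
        rw [← hHB, Matrix.conjTranspose_mul, Matrix.conjTranspose_conjTranspose]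
        simp only [Matrix.mul_assoc]

theorem isTwoUniversal_of_not {H : TwoQubitMatrix} (hH : H.IsHermitian)
    (hL : ¬ ∃ L, IsLocalHamiltonian L ∧ TSimilar H L)
    (hE : ¬ ShareEigenvector H swapGate) (htr : H.trace ≠ 0) : IsTwoUniversal H := by
  obtain ⟨B, hB, hTB, a, b₀, b₁, b₂, hb₀, hb₁, hb₂, hHB⟩ := exists_tridiagonal_basis hH hE
  have hB' := mul_conjTranspose_eq_one hB
  have hHJ : H = conjLinearMap B (tridiagonal a b₀ b₁ b₂) := by
    rw [conjLinearMap_apply, ← hHB, Matrix.mul_assoc, hB', Matrix.mul_one]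
  have hTHT : swapGate * H * swapGate = conjLinearMap B (tridiagonal a (-b₀) b₁ b₂) := by
    have hT : swapGate = B * Matrix.diagonal swapSign * B.conjTranspose := by
      rw [← hTB, Matrix.mul_assoc, hB', Matrix.mul_one]
    rw [conjLinearMap_apply, ← diagonal_swapSign_mul_tridiagonal_mul]
    calc swapGate * H * swapGate
        = swapGate * (H * B) * Matrix.diagonal swapSign * B.conjTranspose := by
          nth_rewrite 2 [hT]
          simp only [Matrix.mul_assoc]
      _ = (swapGate * B) * tridiagonal a b₀ b₁ b₂ * Matrix.diagonal swapSign *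
          B.conjTranspose := by rw [hHB]; simp only [Matrix.mul_assoc]
      _ = _ := by rw [hTB]; simp only [Matrix.mul_assoc]
  have htr' : ∑ i, a i ≠ 0 := by
    intro h
    rw [hHJ, conjLinearMap_apply, Matrix.trace_mul_comm, ← Matrix.mul_assoc, hB, Matrix.one_mul,
      trace_tridiagonal, h, Complex.ofReal_zero] at htr
    exact htr rfl
  have ha : ¬ (a 1 = a 0 ∧ a 2 = a 1 ∧ a 3 = a 2) := by
    rintro ⟨h1, h2, h3⟩
    have hconst : a = fun _ => a 0 := by
      ext i
      fin_cases i <;> simp [h1, h2, h3]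
    rw [hconst] at hHB
    obtain ⟨L, hloc, hLR⟩ := exists_local_mul_bellMatrix (a 0) b₀ b₁ b₂
    exact hL ⟨L, hloc, tSimilar_of_mul_eq hB bellMatrix_conjTranspose_mul hTB
      swapGate_mul_bellMatrix hHB hLR⟩
  have hS := isHermitian_of_mem_pair hH
  set S : Set TwoQubitMatrix := {H, swapGate * H * swapGate} with hSdef
  -- Pulling the Lie algebra back along B allows all brackets to be computed in the tridiagonal
  -- basis.
  set V := (evolutionSubmodule (simulationMonoid S) (isClosed_simulationMonoid S)).comap
    (conjLinearMap B) with hVdef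
  have hV : ∀ X ∈ V, ∀ Y ∈ V, hermitianBracket X Y ∈ V := by
    intro X hX Y hY
    rw [hVdef, Submodule.mem_comap, conjLinearMap_hermitianBracket hB]
    exact commutator_mem_evolutionSubmodule hX hY
  have m1 : tridiagonal a b₀ b₁ b₂ ∈ V := by
    rw [hVdef, Submodule.mem_comap, ← hHJ]
    exact mem_evolutionSubmodule_simulationMonoid hS (by simp [hSdef])
  have m2 : tridiagonal a (-b₀) b₁ b₂ ∈ V := by
    rw [hVdef, Submodule.mem_comap, ← hTHT]
    exact mem_evolutionSubmodule_simulationMonoid hS (by simp [hSdef])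
  have h01 : planeX 0 1 ∈ V := by
    have := V.smul_mem (2 * b₀)⁻¹ (V.sub_mem m1 m2)
    have e : tridiagonal a b₀ b₁ b₂ - tridiagonal a (-b₀) b₁ b₂ = (2 * b₀) • planeX 0 1 := by
      unfold tridiagonal
      module
    rwa [e, smul_smul, inv_mul_cancel₀ (by positivity), one_smul] at this
  have hD : Matrix.diagonal (fun i => (a i : ℂ)) + b₁ • planeX 1 2 + b₂ • planeX 2 3 ∈ V := by
    have := V.sub_mem m1 (V.smul_mem b₀ h01)
    rwa [tridiagonal, add_sub_cancel_right] at this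
  intro U hU
  obtain ⟨A, hA, rfl⟩ := exists_eq_evolution hU
  have hmem : B.conjTranspose * A * B ∈ V :=
    mem_of_tridiagonal hV hb₁.ne' hb₂.ne' h01 hD htr' ha
      (Matrix.isHermitian_conjTranspose_mul_mul B hA)
  have hAB : conjLinearMap B (B.conjTranspose * A * B) = A := by
    calc conjLinearMap B (B.conjTranspose * A * B)
        = (B * B.conjTranspose) * A * (B * B.conjTranspose) := by
          simp only [conjLinearMap_apply, Matrix.mul_assoc]
      _ = A := by rw [hB', Matrix.one_mul, Matrix.mul_one]
  rw [hVdef, Submodule.mem_comap, hAB] at hmem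
  -- U is the evolution of A at time 1.
  exact canSimulate_iff.2 (hmem.2 1)

end Universality

end QubitUniversality

theorem theorem3p6 (H : QubitUniversality.TwoQubitMatrix) (hH : H.IsHermitian) :
    QubitUniversality.IsTwoUniversal H ↔
      ¬ ((∃ L : QubitUniversality.TwoQubitMatrix,
            QubitUniversality.IsLocalHamiltonian L ∧ QubitUniversality.TSimilar H L) ∨
          QubitUniversality.ShareEigenvector H QubitUniversality.swapGate ∨
          H.trace = 0) := by
  constructor
  · rintro huniv (⟨L, hloc, hsim⟩ | hE | htr)
    · exact QubitUniversality.not_isTwoUniversal_of_tSimilar_local hloc hsim huniv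
    · exact QubitUniversality.not_isTwoUniversal_of_shareEigenvector hE huniv
    · exact QubitUniversality.not_isTwoUniversal_of_trace_eq_zero hH htr huniv
  · intro h
    rw [not_or, not_or] at h
    exact QubitUniversality.isTwoUniversal_of_not hH h.1 h.2.1 h.2.2
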